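/- \textbf{Proposition.} There is an absolute constant $C$ such that the following holds. \emph{Setting.} Let $V$ be a finite-dimensional complex Hilbert space with sites labelled by $[n]=\{1,\dots,n\}$ and, for each site $i$, a subalgebra $\mathcal A_i$ of the operators on $V$ (for $n$ qubits: the operators acting on the $i$-th tensor factor; for Majorana fermions: the algebra generated by $\chi_i$). The support of an operator is the smallest set $Z\subset[n]$ (the intersection of all sets $Z$) such that the operator lies in the algebra generated by the $\mathcal A_i$, $i\in Z$. Let $\Gamma$ and $A$ be finite sets, let $H_\gamma$ ($\gamma\in\Gamma$) be Hermitian operators with $H_\gamma^2=h_\gamma^2 I$, $h_\gamma\ge 0$, and let $A^a$ ($a\in A$) be Hermitian operators with $(A^a)^2=I$. Write $S(\gamma)$ for the support of $H_\gamma$. Assume: (1) $[A^a,H_\gamma]=2b_{a\gamma}A^aH_\gamma$ and $[H_\gamma,H_{\gamma'}]=2b_{\gamma\gamma'}H_\gamma H_{\gamma'}$ with $b_{a\gamma},b_{\gamma\gamma'}\in\{0,1\}$, where $b_{a\gamma}=0$ whenever the supports of $A^a$ and $H_\gamma$ are disjoint, and $b_{\gamma\gamma'}=0$ whenever $S(\gamma)\cap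 S(\gamma')=\varnothing$; (2) each $A^a$ is supported on exactly one site, $|S(\gamma)|=k$ for all $\gamma$, and for some real numbers $a_{\mathrm{ac}}\le a_{\mathrm{loc}}$ we have $\sum_{a}b_{a\gamma}=a_{\mathrm{ac}}k$ for every $\gamma$, and for every $Z\subset[n]$ exactly $a_{\mathrm{loc}}|Z|$ of the jumps $A^a$ have support meeting $Z$. Put $\|H\|_{\mathrm{loc}}=\max_{i}\bigl(\sum_{\gamma:\,i\in S(\gamma)}h_\gamma^2\bigr)^{1/2}$ and $\|H\|_{\mathrm{glo}}=\bigl(\sum_\gamma h_\gamma^2\bigr)^{1/2}$. Let $y\in\mathbb R$. For signs $s\in\{\pm1\}^\Gamma$ let $H=\sum_\gamma s_\gamma H_\gamma$, $K^a=A^a+y[A^a,H]$ and $$\mathcal L^\dagger(O)=\sum_{a\in A}\Bigl(K^{a\dagger}OK^a-\tfrac12\{K^{a\dagger}K^a,O\}\Bigr).$$ For $U\subset\Gamma$ let the operator $O_U$ be the coefficient of $\prod_{\alpha\in U}s_\alpha$ in the expansion of $\mathcal L^\dagger(\mathcal L^\dagger(H))$ as a polynomial in the signs $s_\gamma$, after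 cancelling $s_\gamma^2=1$ (each $O_U$ is independent of $s$). \emph{Conclusion.} If $y^2\|H\|_{\mathrm{loc}}^2\,a_{\mathrm{loc}}\,k<1/8$, then $$\mathcal L^\dagger(\mathcal L^\dagger(H))=\sum_{U\subset\Gamma,\ |U|\le5}\Bigl(\prod_{\alpha\in U}s_\alpha\Bigr)O_U\quad\text{for all } s\in\{\pm1\}^\Gamma,$$ and $$\sum_{U\subset\Gamma,\ |U|\le5}\Bigl(\prod_{\alpha\in U}h_\alpha\Bigr)|y|^{|U|}\,\|O_U\|\le C\,|y|\,a_{\mathrm{loc}}^2k^2\,\|H\|_{\mathrm{glo}}^2,$$ where $\|\cdot\|$ is the operator norm. -/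

import Mathlib

open scoped BigOperators

namespace LocalHamiltonian

section Support

variable {V : Type} [NormedAddCommGroup V] [InnerProductSpace ℂ V] {n : ℕ}

/-- The operators that live on a set `Z` of sites: the algebra generated by the site algebras
`𝒜 i`, `i ∈ Z`. For `n` qubits `𝒜 i` is the algebra of operators `I ⊗ ⋯ ⊗ M ⊗ ⋯ ⊗ I` with
`M` in position `i`; for Majorana fermions `𝒜 i` is the algebra generated by `χ i`. -/
def regionAlgebra (𝒜 : Fin n → Subalgebra ℂ (V →L[ℂ] V)) (Z : Set (Fin n)) :
    Subalgebra ℂ (V →L[ℂ] V) :=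
  ⨆ i ∈ Z, 𝒜 i

/-- The support of an operator, i.e. the set of sites on which it acts nontrivially: the smallest
set of sites on which the operator lives (the intersection of all such sets). -/
def support (𝒜 : Fin n → Subalgebra ℂ (V →L[ℂ] V)) (X : V →L[ℂ] V) : Set (Fin n) :=
  {i | ∀ Z : Set (Fin n), X ∈ regionAlgebra 𝒜 Z → i ∈ Z}

/-- The labels of the jump operators whose support meets `Z`. -/
def jumpsMeeting {J : Type} (𝒜 : Fin n → Subalgebra ℂ (V →L[ℂ] V)) (A : J → (V →L[ℂ] V))
    (Z : Finset (Fin n)) : Set J :=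
  {a | (support 𝒜 (A a) ∩ (Z : Set (Fin n))).Nonempty}

end Support

section Conditions

variable {V : Type} [NormedAddCommGroup V] [InnerProductSpace ℂ V] [CompleteSpace V]
variable {n : ℕ} {Γ J : Type}

/-- The Hamiltonian terms are Hermitian and square to `h γ ^ 2` times the identity, where
`h γ ≥ 0` is the strength of the term. -/
structure SquareCondition (H : Γ → (V →L[ℂ] V)) (h : Γ → ℝ) : Prop where
  isSelfAdjoint : ∀ γ, IsSelfAdjoint (H γ)
  nonneg : ∀ γ, 0 ≤ h γ
  sq_eq : ∀ γ, H γ * H γ = ((h γ ^ 2 : ℝ) : ℂ) • (1 : V →L[ℂ] V)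

/-- The jumps are Hermitian and square to the identity; jumps and Hamiltonian terms, and
Hamiltonian terms among themselves, commute (`b = 0`) or anticommute (`b = 1`), and they commute
when their supports are disjoint. -/
structure CommutationCondition (𝒜 : Fin n → Subalgebra ℂ (V →L[ℂ] V))
    (H : Γ → (V →L[ℂ] V)) (A : J → (V →L[ℂ] V)) (b : J → Γ → ℕ) (b' : Γ → Γ → ℕ) : Prop where
  jump_isSelfAdjoint : ∀ a, IsSelfAdjoint (A a)
  jump_sq : ∀ a, A a * A a = 1
  jump_mem : ∀ a γ, b a γ = 0 ∨ b a γ = 1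
  jump_comm : ∀ a γ, ⁅A a, H γ⁆ = (b a γ : ℂ) • ((2 : ℂ) • (A a * H γ))
  jump_disjoint : ∀ a γ, Disjoint (support 𝒜 (A a)) (support 𝒜 (H γ)) → b a γ = 0
  term_mem : ∀ γ γ', b' γ γ' = 0 ∨ b' γ γ' = 1
  term_comm : ∀ γ γ', ⁅H γ, H γ'⁆ = (b' γ γ' : ℂ) • ((2 : ℂ) • (H γ * H γ'))
  term_disjoint : ∀ γ γ', Disjoint (support 𝒜 (H γ)) (support 𝒜 (H γ')) → b' γ γ' = 0

/-- Every jump is supported on one site, every Hamiltonian term on `k` sites, every Hamiltonian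
term anticommutes with `aac * k` jumps, and `aloc * |Z|` jumps act on each set `Z` of sites. -/
structure LocalityCondition [Fintype J] (𝒜 : Fin n → Subalgebra ℂ (V →L[ℂ] V))
    (H : Γ → (V →L[ℂ] V)) (A : J → (V →L[ℂ] V)) (b : J → Γ → ℕ)
    (k : ℕ) (aloc aac : ℝ) : Prop where
  jump_single : ∀ a, ∃ i, support 𝒜 (A a) = {i}
  term_card : ∀ γ, (support 𝒜 (H γ)).ncard = k
  aac_le_aloc : aac ≤ aloc
  anticomm_count : ∀ γ, ((∑ a, b a γ : ℕ) : ℝ) = aac * k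
  jump_count : ∀ Z : Finset (Fin n), ((jumpsMeeting 𝒜 A Z).ncard : ℝ) = aloc * Z.card

end Conditions

section Energies

variable {V : Type} [NormedAddCommGroup V] [InnerProductSpace ℂ V]
variable {n : ℕ} {Γ : Type} [Fintype Γ]

open Classical in
/-- The local energy `max_i √(∑_{γ : i ∈ S(γ)} h_γ²)`. -/
noncomputable def localEnergy (𝒜 : Fin n → Subalgebra ℂ (V →L[ℂ] V))
    (H : Γ → (V →L[ℂ] V)) (h : Γ → ℝ) : ℝ :=
  ⨆ i : Fin n, √(∑ γ with i ∈ support 𝒜 (H γ), h γ ^ 2)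

/-- The global energy `√(∑_γ h_γ²)`. -/
noncomputable def globalEnergy (h : Γ → ℝ) : ℝ :=
  √(∑ γ, h γ ^ 2)

end Energies

section Lindbladian

variable {V : Type} [NormedAddCommGroup V] [InnerProductSpace ℂ V] [CompleteSpace V]
variable {Γ J : Type} [Fintype Γ] [Fintype J]

/-- The Hamiltonian `∑_γ s_γ H_γ` for given signs `s_γ = ±1`. -/
def hamiltonian (H : Γ → (V →L[ℂ] V)) (s : Γ → ℤˣ) : V →L[ℂ] V :=
  ∑ γ, s γ • H γ

/-- The polarized dissipator `P† X Q - ½ {P† Q, X}`. -/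
noncomputable def dissipator (P Q X : V →L[ℂ] V) : V →L[ℂ] V :=
  star P * X * Q - (1 / 2 : ℂ) • (star P * Q * X + X * (star P * Q))

/-- The Lindblad operator `K^a = A^a + y [A^a, H]`, where `H` is the signed Hamiltonian. -/
def lindbladOperator (H : Γ → (V →L[ℂ] V)) (A : J → (V →L[ℂ] V)) (y : ℝ)
    (s : Γ → ℤˣ) (a : J) : V →L[ℂ] V :=
  A a + (y : ℂ) • ⁅A a, hamiltonian H s⁆

/-- The Lindbladian in the Heisenberg picture,
`L†(X) = ∑_a (K^a† X K^a - ½ {K^a† K^a, X})`. -/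
noncomputable def lindbladian (H : Γ → (V →L[ℂ] V)) (A : J → (V →L[ℂ] V)) (y : ℝ)
    (s : Γ → ℤˣ) (X : V →L[ℂ] V) : V →L[ℂ] V :=
  ∑ a, dissipator (lindbladOperator H A y s a) (lindbladOperator H A y s a) X

/-- The coefficients of `K^a` as a polynomial of degree one in the signs: `A^a` is the constant
term (label `none`) and `y [A^a, H_γ]` is the coefficient of `s_γ` (label `some γ`). -/
def lindbladOperatorCoeff (H : Γ → (V →L[ℂ] V)) (A : J → (V →L[ℂ] V)) (y : ℝ) (a : J) :
    Option Γ → (V →L[ℂ] V)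
  | none => A a
  | some γ => (y : ℂ) • ⁅A a, H γ⁆

/-- The coefficient of the monomial `s_p s_q` of the Lindbladian, which is a polynomial of degree
two in the signs (with `s_none = 1`). -/
noncomputable def lindbladianCoeff (H : Γ → (V →L[ℂ] V)) (A : J → (V →L[ℂ] V)) (y : ℝ)
    (p q : Option Γ) (X : V →L[ℂ] V) : V →L[ℂ] V :=
  ∑ a, dissipator (lindbladOperatorCoeff H A y a p) (lindbladOperatorCoeff H A y a q) X

/-- The signs that survive in the monomial `∏_{p ∈ l} s_p` (with `s_none = 1`) after cancelling
`s_α ^ 2 = 1`: those that occur an odd number of times. -/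
def survivingSigns [DecidableEq Γ] (l : List (Option Γ)) : Finset Γ :=
  {α | Odd (l.count (some α))}

/-- The coefficient `O_U` of `∏_{α ∈ U} s_α` in `L†(L†(H))`, where `L†(L†(H))` is expanded as a
polynomial in the signs and squares of signs are cancelled: the sum of all terms of the expansion
in which exactly the signs with label in `U` survive. -/
noncomputable def expansionCoeff [DecidableEq Γ] (H : Γ → (V →L[ℂ] V)) (A : J → (V →L[ℂ] V))
    (y : ℝ) (U : Finset Γ) : V →L[ℂ] V :=
  ∑ γ₀ : Γ, ∑ p₁ : Option Γ, ∑ p₂ : Option Γ, ∑ p₃ : Option Γ, ∑ p₄ : Option Γ,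
    if survivingSigns [some γ₀, p₁, p₂, p₃, p₄] = U then
      lindbladianCoeff H A y p₄ p₃ (lindbladianCoeff H A y p₂ p₁ (H γ₀))
    else 0

end Lindbladian

end LocalHamiltonian

/-! Write each `K^a` as a sum over labels `p : Option Γ`, with `none` for `A^a`. Then `L†(L†(H))` is
a sum over an initial label `γ₀` and four further labels, and each tuple contributes to exactly one
`O_U`. Give a monomial with surviving signs `u` the weight `w(u) = ∏ h_α |y|`, and put `M = aloc *
k`. By the triangle inequality it is enough that each of the two applications of `L†` multiplies the
sum of weight times norm by at most `1872 * M`, since the starting value is `∑ w({γ}) h_γ = |y| ∑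
h_γ²`.

Algebra: every operator that arises commutes or anticommutes with each jump and each term (`Tame`).
On such an `X`, the `(p, q)` part of the dissipator of a jump is a scalar times `X H_p H_q`, and the
scalar vanishes when `X` commutes with the jump, with `H_p` and with `H_q`
(`Tame.exists_dissipator_eq`). Hence only anticommuting jumps and labels count.

Weights: appending `γ` costs norm `2|y|h_γ`. If its sign is new, the weight gains `h_γ|y|`, and the
total `2(h_γ|y|)²` is summable near a site by the smallness hypothesis. If its sign cancels, the
weight loses `h_γ|y|`, but the norm cost makes up for this up to a factor 2, and only the few labels
already present can cancel. This is `monomialWeight_toggle_le`; `CountingBounds.sum_pairNorm_le`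
turns it into the one-step bound, and `LocalityCondition.countingBounds` supplies the counting.

Two label sets run through the argument: `u` holds the surviving signs and fixes the weight; `l ⊇ u`
also keeps cancelled labels and controls anticommutation. -/

namespace LocalHamiltonian

/-! ### Multiplying sign monomials modulo `s_γ² = 1`. -/

section Toggle

variable {Γ : Type} [DecidableEq Γ]

/-- Multiplication of a monomial with set of signs `u` by the label `p`. -/
def toggle (p : Option Γ) (u : Finset Γ) : Finset Γ := symmDiff p.toFinset u

lemma toggle_none (u : Finset Γ) : toggle none u = u := by
  ext α; simp [toggle, Finset.mem_symmDiff]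

lemma toggle_some_of_mem {γ : Γ} {u : Finset Γ} (h : γ ∈ u) : toggle (some γ) u = u.erase γ := by
  ext α
  simp only [toggle, Option.toFinset_some, Finset.mem_symmDiff, Finset.mem_singleton,
    Finset.mem_erase]
  grind

lemma toggle_some_of_notMem {γ : Γ} {u : Finset Γ} (h : γ ∉ u) :
    toggle (some γ) u = insert γ u := by
  ext α
  simp only [toggle, Option.toFinset_some, Finset.mem_symmDiff, Finset.mem_singleton,
    Finset.mem_insert]
  grind

/-- The value of the label `p` under the signs `s`, with `s_none = 1`. -/
def labelSign (s : Γ → ℤˣ) : Option Γ → ℤˣ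
  | none => 1
  | some γ => s γ

lemma prod_toggle (s : Γ → ℤˣ) (p : Option Γ) (u : Finset Γ) :
    ∏ α ∈ toggle p u, s α = labelSign s p * ∏ α ∈ u, s α := by
  rcases p with _ | γ
  · simp [toggle_none, labelSign]
  · by_cases h : γ ∈ u
    · rw [toggle_some_of_mem h, labelSign, ← Finset.mul_prod_erase u s h, ← mul_assoc,
        Int.units_mul_self, one_mul]
    · rw [toggle_some_of_notMem h, labelSign, Finset.prod_insert h]

end Toggle

/-! ### Expansion of the Lindbladian in the signs. -/

section Expansion

lemma lindbladOperator_eq_sum {V Γ J : Type} [NormedAddCommGroup V]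
    [InnerProductSpace ℂ V] [Fintype Γ] (H : Γ → (V →L[ℂ] V)) (A : J → (V →L[ℂ] V)) (y : ℝ)
    (s : Γ → ℤˣ) (a : J) :
    lindbladOperator H A y s a = ∑ p, labelSign s p • lindbladOperatorCoeff H A y a p := by
  simp only [lindbladOperator, hamiltonian, Fintype.sum_option, labelSign, lindbladOperatorCoeff,
    one_smul, Ring.lie_def, Finset.mul_sum, Finset.sum_mul, ← Finset.sum_sub_distrib,
    Finset.smul_sum]
  congr 1
  refine Finset.sum_congr rfl fun γ _ => ?_
  rcases Int.units_eq_one_or (s γ) with h | h <;> simp [h, Units.neg_smul]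
  module

variable {V : Type} [NormedAddCommGroup V] [InnerProductSpace ℂ V] [CompleteSpace V]
variable {Γ J : Type}

lemma dissipator_smul (u v w : ℤˣ) (P Q X : V →L[ℂ] V) :
    dissipator (u • P) (v • Q) (w • X) = (w * (u * v)) • dissipator P Q X := by
  rcases Int.units_eq_one_or u with rfl | rfl <;> rcases Int.units_eq_one_or v with rfl | rfl <;>
    rcases Int.units_eq_one_or w with rfl | rfl <;>
    simp [dissipator, Units.neg_smul] <;> abel_nf

lemma dissipator_sum_left {ι : Type} (S : Finset ι) (P : ι → (V →L[ℂ] V)) (Q X : V →L[ℂ] V) :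
    dissipator (∑ i ∈ S, P i) Q X = ∑ i ∈ S, dissipator (P i) Q X := by
  simp only [dissipator, star_sum, Finset.sum_mul, Finset.mul_sum, Finset.smul_sum,
    Finset.sum_sub_distrib, Finset.sum_add_distrib, smul_add]

lemma dissipator_sum_middle {ι : Type} (S : Finset ι) (P X : V →L[ℂ] V) (Q : ι → (V →L[ℂ] V)) :
    dissipator P (∑ i ∈ S, Q i) X = ∑ i ∈ S, dissipator P (Q i) X := by
  simp only [dissipator, Finset.sum_mul, Finset.mul_sum, Finset.smul_sum,
    Finset.sum_sub_distrib, Finset.sum_add_distrib, smul_add]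

lemma dissipator_sum_right {ι : Type} (S : Finset ι) (P Q : V →L[ℂ] V) (X : ι → (V →L[ℂ] V)) :
    dissipator P Q (∑ i ∈ S, X i) = ∑ i ∈ S, dissipator P Q (X i) := by
  simp only [dissipator, Finset.sum_mul, Finset.mul_sum, Finset.smul_sum,
    Finset.sum_sub_distrib, Finset.sum_add_distrib, smul_add]

variable [Fintype Γ] [Fintype J] (H : Γ → (V →L[ℂ] V)) (A : J → (V →L[ℂ] V)) (y : ℝ)

lemma lindbladian_sum {ι : Type} (S : Finset ι) (s : Γ → ℤˣ) (X : ι → (V →L[ℂ] V)) :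
    lindbladian H A y s (∑ i ∈ S, X i) = ∑ i ∈ S, lindbladian H A y s (X i) := by
  simp only [lindbladian, dissipator_sum_right]
  exact Finset.sum_comm

lemma lindbladian_smul_eq_sum (s : Γ → ℤˣ) (w : ℤˣ) (X : V →L[ℂ] V) :
    lindbladian H A y s (w • X) =
      ∑ q, ∑ p, (w * (labelSign s p * labelSign s q)) • lindbladianCoeff H A y p q X := by
  simp only [lindbladian, lindbladOperator_eq_sum, dissipator_sum_left, dissipator_sum_middle,
    dissipator_smul, lindbladianCoeff, Finset.smul_sum]
  rw [Finset.sum_comm]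
  refine Finset.sum_congr rfl fun q _ => ?_
  rw [Finset.sum_comm]

variable [DecidableEq Γ]

lemma survivingSigns_cons (p : Option Γ) (l : List (Option Γ)) :
    survivingSigns (p :: l) = toggle p (survivingSigns l) := by
  ext α
  rcases p with _ | γ
  · simp [survivingSigns, toggle, Finset.mem_symmDiff]
  · by_cases h : γ = α
    · subst h
      simp [survivingSigns, toggle, List.count_cons, Finset.mem_symmDiff, Nat.odd_add_one]
    · simp [survivingSigns, toggle, List.count_cons, Finset.mem_symmDiff, h, Ne.symm h]

lemma survivingSigns_nil : survivingSigns ([] : List (Option Γ)) = ∅ := by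
  simp [survivingSigns]

lemma survivingSigns_perm {l l' : List (Option Γ)} (h : l.Perm l') :
    survivingSigns l = survivingSigns l' := by
  ext α
  simp [survivingSigns, h.count_eq]

lemma prod_survivingSigns (s : Γ → ℤˣ) (l : List (Option Γ)) :
    ∏ α ∈ survivingSigns l, s α = (l.map (labelSign s)).prod := by
  induction l with
  | nil => simp [survivingSigns_nil]
  | cons p l ih => rw [survivingSigns_cons, prod_toggle, ih, List.map_cons, List.prod_cons]

lemma card_survivingSigns_le (l : List (Option Γ)) : (survivingSigns l).card ≤ l.length := by
  induction l with
  | nil => simp [survivingSigns_nil]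
  | cons p l ih =>
    rw [survivingSigns_cons, List.length_cons]
    have h1 : toggle p (survivingSigns l) ⊆ p.toFinset ∪ survivingSigns l := by
      intro α; simp only [toggle, Finset.mem_symmDiff, Finset.mem_union]; tauto
    have h2 : p.toFinset.card ≤ 1 := by rcases p with _ | γ <;> simp
    have := (Finset.card_le_card h1).trans (Finset.card_union_le _ _)
    omega

/-- Both sides are the same sum over label tuples: a tuple belongs to the single `U` of its
surviving signs, and `|U| ≤ 5` because a tuple has five labels. -/
theorem lindbladian_lindbladian_hamiltonian (s : Γ → ℤˣ) :
    lindbladian H A y s (lindbladian H A y s (hamiltonian H s)) =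
      ∑ U : Finset Γ with U.card ≤ 5, (∏ α ∈ U, s α) • expansionCoeff H A y U := by
  have hR : ∑ U : Finset Γ with U.card ≤ 5, (∏ α ∈ U, s α) • expansionCoeff H A y U =
      ∑ γ₀ : Γ, ∑ p₁ : Option Γ, ∑ p₂ : Option Γ, ∑ p₃ : Option Γ, ∑ p₄ : Option Γ,
        (([some γ₀, p₁, p₂, p₃, p₄] : List (Option Γ)).map (labelSign s)).prod •
          lindbladianCoeff H A y p₄ p₃ (lindbladianCoeff H A y p₂ p₁ (H γ₀)) := by
    simp only [expansionCoeff, Finset.smul_sum]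
    rw [Finset.sum_comm]; refine Finset.sum_congr rfl fun γ₀ _ => ?_
    rw [Finset.sum_comm]; refine Finset.sum_congr rfl fun p₁ _ => ?_
    rw [Finset.sum_comm]; refine Finset.sum_congr rfl fun p₂ _ => ?_
    rw [Finset.sum_comm]; refine Finset.sum_congr rfl fun p₃ _ => ?_
    rw [Finset.sum_comm]; refine Finset.sum_congr rfl fun p₄ _ => ?_
    rw [Finset.sum_eq_single (survivingSigns [some γ₀, p₁, p₂, p₃, p₄])]
    · rw [if_pos rfl, prod_survivingSigns]
    · intro U _ hU
      rw [if_neg (Ne.symm hU), smul_zero]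
    · intro hU
      refine absurd (Finset.mem_filter.2 ⟨Finset.mem_univ _, ?_⟩) hU
      exact card_survivingSigns_le [some γ₀, p₁, p₂, p₃, p₄]
  rw [hR, hamiltonian]
  simp only [lindbladian_sum, lindbladian_smul_eq_sum]
  refine Finset.sum_congr rfl fun γ₀ _ => Finset.sum_congr rfl fun p₁ _ =>
    Finset.sum_congr rfl fun p₂ _ => Finset.sum_congr rfl fun p₃ _ =>
    Finset.sum_congr rfl fun p₄ _ => ?_
  congr 1
  simp only [List.map_cons, List.map_nil, List.prod_cons, List.prod_nil, labelSign]
  grind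

end Expansion

/-! ### Weights of monomials and the cost of appending a label. -/

section Labels

variable {Γ J : Type}

/-- Whether the jump `a` has a term with label `p` in its Lindblad operator. -/
def labelJump (b : J → Γ → ℕ) (a : J) : Option Γ → ℝ
  | none => 1
  | some γ => b a γ

/-- The number of labels in `l` that anticommute with the jump `a`. -/
def jumpOverlap (b : J → Γ → ℕ) (l : Finset Γ) (a : J) : ℝ := ∑ γ ∈ l, (b a γ : ℝ)

/-- The number of labels in `l` that anticommute with the label `p`. -/
def labelOverlap (b' : Γ → Γ → ℕ) (l : Finset Γ) : Option Γ → ℝ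
  | none => 0
  | some γ => ∑ γ' ∈ l, (b' γ γ' : ℝ)

/-- The norm of the term with label `p` of a Lindblad operator. -/
def labelStrength (h : Γ → ℝ) (y : ℝ) : Option Γ → ℝ
  | none => 1
  | some γ => 2 * |y| * h γ

/-- The weight gained by appending the label `p` to a monomial with signs in `u`. -/
def labelMass [DecidableEq Γ] (h : Γ → ℝ) (y : ℝ) (u : Finset Γ) : Option Γ → ℝ
  | none => 1
  | some γ => (h γ * |y|) ^ 2 + if γ ∈ u then 1 else 0

/-- The weight `∏_{α ∈ u} h_α |y|` of a monomial. -/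
def monomialWeight (h : Γ → ℝ) (y : ℝ) (u : Finset Γ) : ℝ := ∏ α ∈ u, (h α * |y|)

lemma labelJump_nonneg (b : J → Γ → ℕ) (a : J) (p : Option Γ) : 0 ≤ labelJump b a p := by
  cases p <;> simp [labelJump]

lemma jumpOverlap_nonneg (b : J → Γ → ℕ) (l : Finset Γ) (a : J) : 0 ≤ jumpOverlap b l a :=
  Finset.sum_nonneg fun _ _ => Nat.cast_nonneg _

lemma labelOverlap_nonneg (b' : Γ → Γ → ℕ) (l : Finset Γ) (p : Option Γ) :
    0 ≤ labelOverlap b' l p := by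
  rcases p with _ | γ
  · exact le_rfl
  · exact Finset.sum_nonneg fun _ _ => Nat.cast_nonneg _

lemma one_le_jumpOverlap {b : J → Γ → ℕ} {l : Finset Γ} {a : J} {γ : Γ} (hγ : γ ∈ l)
    (h : b a γ = 1) : 1 ≤ jumpOverlap b l a := by
  have := Finset.single_le_sum (f := fun γ => (b a γ : ℝ)) (fun _ _ => Nat.cast_nonneg _) hγ
  simpa [h, jumpOverlap] using this

lemma one_le_labelOverlap {b' : Γ → Γ → ℕ} {l : Finset Γ} {γ γ' : Γ} (hγ : γ' ∈ l)
    (h : b' γ γ' = 1) : 1 ≤ labelOverlap b' l (some γ) := by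
  have := Finset.single_le_sum (f := fun γ' => (b' γ γ' : ℝ)) (fun _ _ => Nat.cast_nonneg _) hγ
  simpa [h, labelOverlap] using this

variable {h : Γ → ℝ} {y : ℝ}

lemma labelStrength_nonneg (hh : ∀ γ, 0 ≤ h γ) (p : Option Γ) : 0 ≤ labelStrength h y p := by
  rcases p with _ | γ
  · exact zero_le_one
  · have := hh γ
    simp only [labelStrength]; positivity

lemma monomialWeight_nonneg (hh : ∀ γ, 0 ≤ h γ) (u : Finset Γ) : 0 ≤ monomialWeight h y u :=
  Finset.prod_nonneg fun γ _ => mul_nonneg (hh γ) (abs_nonneg y)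

lemma monomialWeight_eq (u : Finset Γ) :
    monomialWeight h y u = (∏ α ∈ u, h α) * |y| ^ u.card := by
  simp [monomialWeight, Finset.prod_mul_distrib]

variable [DecidableEq Γ]

lemma labelMass_nonneg (u : Finset Γ) (p : Option Γ) : 0 ≤ labelMass h y u p := by
  rcases p with _ | γ
  · exact zero_le_one
  · simp only [labelMass]; positivity

lemma labelMass_mono {u l : Finset Γ} (hul : u ⊆ l) (p : Option Γ) :
    labelMass h y u p ≤ labelMass h y l p := by
  rcases p with _ | γ
  · exact le_rfl
  · simp only [labelMass]
    have := @hul γ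
    gcongr
    split_ifs <;> simp_all

/-- Toggling `q` can bring no label other than `q` into the monomial, so the indicator in the mass
of `p` can grow only when `p = q`. -/
lemma labelMass_toggle_le (p q : Option Γ) (u : Finset Γ) :
    labelMass h y (toggle q u) p ≤ labelMass h y u p + if p = q then 1 else 0 := by
  rcases p with _ | γ
  · simp only [labelMass]; split_ifs <;> norm_num
  · have hm : γ ∈ toggle q u → γ ∉ u → some γ = q := by
      simp only [toggle, Finset.mem_symmDiff, Option.mem_toFinset, Option.mem_def]
      intro h1 h2; tauto
    simp only [labelMass, add_assoc]
    gcongr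
    split_ifs with h1 h2 h3 h3 <;> first | exact absurd (hm h1 h2) h3 | norm_num

/-- A cancelling label removes a factor `h γ * |y|` that its strength `2 * |y| * h γ` restores, so
no division by `h γ` occurs; a new label contributes this factor twice. The two cases are the two
summands of `labelMass`. -/
lemma monomialWeight_toggle_le (hh : ∀ γ, 0 ≤ h γ) (p : Option Γ) (u : Finset Γ) :
    monomialWeight h y (toggle p u) * labelStrength h y p ≤
      2 * (monomialWeight h y u * labelMass h y u p) := by
  have h0 := monomialWeight_nonneg (y := y) hh u
  rcases p with _ | γ
  · simp only [toggle_none, labelStrength, labelMass]; linarith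
  · by_cases hu : γ ∈ u
    · have h1 := Finset.mul_prod_erase u (fun α => h α * |y|) hu
      rw [toggle_some_of_mem hu]
      simp only [labelStrength, labelMass, if_pos hu, monomialWeight] at h0 ⊢
      rw [← h1] at h0 ⊢
      nlinarith [mul_nonneg h0 (sq_nonneg (h γ * |y|))]
    · rw [toggle_some_of_notMem hu]
      simp only [labelStrength, labelMass, if_neg hu, monomialWeight, Finset.prod_insert hu]
      exact le_of_eq (by ring)

lemma monomialWeight_toggle_toggle_le (hh : ∀ γ, 0 ≤ h γ) (p q : Option Γ) {u l : Finset Γ}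
    (hul : u ⊆ l) :
    monomialWeight h y (toggle p (toggle q u)) * (labelStrength h y p * labelStrength h y q) ≤
      4 * monomialWeight h y u *
        (labelMass h y l q * (labelMass h y l p + if p = q then 1 else 0)) := by
  have h1 := monomialWeight_toggle_le (y := y) hh p (toggle q u)
  have h2 := monomialWeight_toggle_le (y := y) hh q u
  have h3 : labelMass h y (toggle q u) p ≤ labelMass h y l p + if p = q then 1 else 0 :=
    (labelMass_toggle_le p q u).trans (by gcongr; exact labelMass_mono hul p)
  have h4 := labelMass_mono (h := h) (y := y) hul q
  have hq := labelStrength_nonneg (y := y) hh q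
  have hm := labelMass_nonneg (h := h) (y := y) (toggle q u) p
  have hu := monomialWeight_nonneg (y := y) hh u
  have hmq := labelMass_nonneg (h := h) (y := y) l q
  calc _ = monomialWeight h y (toggle p (toggle q u)) * labelStrength h y p *
        labelStrength h y q := by ring
    _ ≤ 2 * (monomialWeight h y (toggle q u) * labelMass h y (toggle q u) p) *
        labelStrength h y q := by gcongr
    _ = 2 * (monomialWeight h y (toggle q u) * labelStrength h y q) *
        labelMass h y (toggle q u) p := by ring
    _ ≤ 2 * (2 * (monomialWeight h y u * labelMass h y u q)) *
        labelMass h y (toggle q u) p := by gcongr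
    _ ≤ 2 * (2 * (monomialWeight h y u * labelMass h y l q)) *
        (labelMass h y l p + if p = q then 1 else 0) := by gcongr
    _ = _ := by ring

end Labels

/-! ### Summing over pairs of labels and over jumps. -/

section Counting

/-- For a fixed jump the double sum factorises: with `P = ∑ m β` and `R = ∑ m β B`, the product part
equals `D P² + 2 P R` and the diagonal part is at most `D P + 2 R`. Only one factor `P` or `R` per
jump needs to be paired with the sum over jumps; the remaining `P` are bounded uniformly by `c`. -/
lemma sum_pair_le {O J : Type} [Fintype O] [DecidableEq O] [Fintype J] (m B : O → ℝ)
    (β : J → O → ℝ) (D : J → ℝ) {c r t : ℝ} (hc : 0 ≤ c)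
    (hm : ∀ p, 0 ≤ m p) (hB : ∀ p, 0 ≤ B p) (hD : ∀ a, 0 ≤ D a) (hβ : ∀ a p, 0 ≤ β a p)
    (hβ1 : ∀ a p, β a p ≤ 1) (hP : ∀ a, ∑ p, m p * β a p ≤ c)
    (hR : ∑ a, ∑ p, m p * β a p * B p ≤ r) (hT : ∑ a, D a ≤ t) :
    ∑ p, ∑ q, m q * (m p + if p = q then 1 else 0) *
      ∑ a, β a p * β a q * (D a + B p + B q) ≤ c ^ 2 * t + 2 * (c * r) + c * t + 2 * r := by
  set P : J → ℝ := fun a => ∑ p, m p * β a p with hPdef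
  set R : J → ℝ := fun a => ∑ p, m p * β a p * B p with hRdef
  have hP0 : ∀ a, 0 ≤ P a := fun a =>
    Finset.sum_nonneg fun p _ => mul_nonneg (hm p) (hβ a p)
  have hR0 : ∀ a, 0 ≤ R a := fun a =>
    Finset.sum_nonneg fun p _ => mul_nonneg (mul_nonneg (hm p) (hβ a p)) (hB p)
  have key : ∀ a, ∑ p, ∑ q, m q * (m p + if p = q then 1 else 0) *
      (β a p * β a q * (D a + B p + B q)) ≤ D a * c ^ 2 + 2 * (c * R a) + c * D a + 2 * R a := by
    intro a
    have h1 : ∑ p, ∑ q, m q * m p * (β a p * β a q * (D a + B p + B q)) =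
        D a * P a ^ 2 + 2 * (P a * R a) := by
      have e1 : P a ^ 2 = ∑ p, ∑ q, (m p * β a p) * (m q * β a q) := by
        rw [sq, hPdef, Finset.sum_mul_sum]
      have e2 : P a * R a = ∑ p, ∑ q, (m p * β a p) * (m q * β a q * B q) := by
        rw [hPdef, hRdef, Finset.sum_mul_sum]
      have e3 : R a * P a = ∑ p, ∑ q, (m p * β a p * B p) * (m q * β a q) := by
        rw [hPdef, hRdef, Finset.sum_mul_sum]
      have e4 : 2 * (P a * R a) = P a * R a + R a * P a := by ring
      rw [e4, e1, e2, e3]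
      simp only [Finset.mul_sum, ← Finset.sum_add_distrib]
      refine Finset.sum_congr rfl fun p _ => Finset.sum_congr rfl fun q _ => by ring
    have h2 : ∑ p, ∑ q, m q * (if p = q then 1 else 0) * (β a p * β a q * (D a + B p + B q)) ≤
        D a * P a + 2 * R a := by
      have e1 : D a * P a + 2 * R a = ∑ p, m p * β a p * (D a + B p + B p) := by
        simp only [hPdef, hRdef, Finset.mul_sum, ← Finset.sum_add_distrib]
        exact Finset.sum_congr rfl fun p _ => by ring
      rw [e1]
      refine Finset.sum_le_sum fun p _ => ?_
      rw [Finset.sum_eq_single p (fun q _ hq => by simp [Ne.symm hq]) (by simp)]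
      -- On the diagonal `β` appears squared; `β ≤ 1` reduces it to the sums `P` and `R`.
      have h3 : m p * β a p * β a p ≤ m p * β a p :=
        mul_le_of_le_one_right (mul_nonneg (hm p) (hβ a p)) (hβ1 a p)
      have h4 : 0 ≤ D a + B p + B p := by linarith [hD a, hB p]
      simpa [mul_assoc] using mul_le_mul_of_nonneg_right h3 h4
    have h5 : D a * P a ^ 2 ≤ D a * c ^ 2 := by
      have := hP a; have := hP0 a; have := hD a; gcongr
    have h6 : P a * R a ≤ c * R a := mul_le_mul_of_nonneg_right (hP a) (hR0 a)
    have h7 : D a * P a ≤ c * D a := by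
      rw [mul_comm c]; exact mul_le_mul_of_nonneg_left (hP a) (hD a)
    simp only [mul_add, add_mul, Finset.sum_add_distrib] at h1 h2 ⊢
    linarith
  have hsum : ∑ p, ∑ q, m q * (m p + if p = q then 1 else 0) *
      ∑ a, β a p * β a q * (D a + B p + B q) = ∑ a, ∑ p, ∑ q,
        m q * (m p + if p = q then 1 else 0) * (β a p * β a q * (D a + B p + B q)) := by
    simp only [Finset.mul_sum]
    rw [Finset.sum_comm]
    refine (Finset.sum_congr rfl fun p _ => Finset.sum_comm).trans ?_
    rw [Finset.sum_comm]
    exact Finset.sum_congr rfl fun a _ => Finset.sum_comm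
  rw [hsum]
  refine (Finset.sum_le_sum fun a _ => key a).trans ?_
  simp only [Finset.sum_add_distrib, ← Finset.mul_sum, ← Finset.sum_mul]
  have h8 : (∑ a, D a) * c ^ 2 ≤ t * c ^ 2 := by gcongr
  have h9 : c * ∑ a, R a ≤ c * r := by gcongr
  have h10 : c * ∑ a, D a ≤ c * t := by gcongr
  linarith

lemma sum_labelJump_mul_nonneg {Γ J : Type} [Fintype J] (b : J → Γ → ℕ) (b' : Γ → Γ → ℕ) (l : Finset Γ)
    (p q : Option Γ) : 0 ≤ ∑ a, labelJump b a p * labelJump b a q *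
      (jumpOverlap b l a + labelOverlap b' l p + labelOverlap b' l q) :=
  Finset.sum_nonneg fun _ _ => mul_nonneg (mul_nonneg (labelJump_nonneg _ _ _)
    (labelJump_nonneg _ _ _)) (add_nonneg (add_nonneg (jumpOverlap_nonneg _ _ _)
    (labelOverlap_nonneg _ _ _)) (labelOverlap_nonneg _ _ _))

/-- The bound for `‖L_{pq}(X)‖ / ‖X‖` when `X` is a product of terms with labels in `l`. -/
noncomputable def pairNorm {Γ J : Type} [Fintype J] (h : Γ → ℝ) (y : ℝ) (b : J → Γ → ℕ) (b' : Γ → Γ → ℕ) (l : Finset Γ)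
    (p q : Option Γ) : ℝ :=
  labelStrength h y p * labelStrength h y q * (2 * ∑ a, labelJump b a p * labelJump b a q *
    (jumpOverlap b l a + labelOverlap b' l p + labelOverlap b' l q))

lemma pairNorm_nonneg {Γ J : Type} [Fintype J] {h : Γ → ℝ} {y : ℝ} {b : J → Γ → ℕ}
    {b' : Γ → Γ → ℕ} (hh : ∀ γ, 0 ≤ h γ) (l : Finset Γ) (p q : Option Γ) :
    0 ≤ pairNorm h y b b' l p q :=
  mul_nonneg (mul_nonneg (labelStrength_nonneg hh p) (labelStrength_nonneg hh q))
    (mul_nonneg zero_le_two (sum_labelJump_mul_nonneg b b' l p q))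

variable {Γ J : Type} [Fintype Γ] [DecidableEq Γ] [Fintype J]
variable {h : Γ → ℝ} {y M : ℝ} {b : J → Γ → ℕ} {b' : Γ → Γ → ℕ}

/-- The counting facts about jumps and labels that locality provides. -/
structure CountingBounds (h : Γ → ℝ) (y M : ℝ) (b : J → Γ → ℕ) (b' : Γ → Γ → ℕ) : Prop where
  strength_nonneg : ∀ γ, 0 ≤ h γ
  nonneg : 0 ≤ M
  jump_le : ∀ a γ, b a γ ≤ 1
  term_le : ∀ γ γ', b' γ γ' ≤ 1
  sum_jumps : ∀ γ, ∑ a, (b a γ : ℝ) ≤ M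
  sum_mass : ∀ a, ∑ γ, (h γ * |y|) ^ 2 * b a γ ≤ 1
  sum_neighbours : ∀ γ', (∑ γ, (h γ * |y|) ^ 2 * b' γ γ') * M ≤ M

lemma CountingBounds.sum_labels_le (hb : CountingBounds h y M b b') {l : Finset Γ}
    (hl : l.card ≤ 3) :
    ∑ p, ∑ q, labelMass h y l q * (labelMass h y l p + if p = q then 1 else 0) *
      ∑ a, labelJump b a p * labelJump b a q *
        (jumpOverlap b l a + labelOverlap b' l p + labelOverlap b' l q) ≤ 234 * M := by
  have hl' : (l.card : ℝ) ≤ 3 := by exact_mod_cast hl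
  have hM := hb.nonneg
  have hlM : (l.card : ℝ) * M ≤ 3 * M := by gcongr
  have hbr : ∀ a γ, (b a γ : ℝ) ≤ 1 := fun a γ => by exact_mod_cast hb.jump_le a γ
  have hbr' : ∀ γ γ', (b' γ γ' : ℝ) ≤ 1 := fun a γ => by exact_mod_cast hb.term_le a γ
  -- `5 = 1 + 1 + 3`: the label `none`, the mass of new signs, and the labels in `l`.
  have hP : ∀ a, ∑ p, labelMass h y l p * labelJump b a p ≤ 5 := by
    intro a
    simp only [Fintype.sum_option, labelMass, labelJump, add_mul, Finset.sum_add_distrib,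
      ite_mul, one_mul, zero_mul, Finset.sum_ite_mem, Finset.univ_inter]
    have h1 := hb.sum_mass a
    have h2 : ∑ γ ∈ l, (b a γ : ℝ) ≤ l.card := by
      simpa using Finset.sum_le_card_nsmul l (fun γ => (b a γ : ℝ)) 1 fun γ _ => hbr a γ
    linarith
  have hT : ∑ a, jumpOverlap b l a ≤ 3 * M := by
    simp only [jumpOverlap]
    rw [Finset.sum_comm]
    refine (Finset.sum_le_card_nsmul l _ M fun γ _ => hb.sum_jumps γ).trans ?_
    simpa using hlM
  -- `12 = 3 + 9`: neighbours of each of at most three labels, and pairs of labels inside `l`. The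
  -- label `none` has overlap zero.
  have hR : ∑ a, ∑ p, labelMass h y l p * labelJump b a p * labelOverlap b' l p ≤ 12 * M := by
    have e1 : ∑ a, ∑ p, labelMass h y l p * labelJump b a p * labelOverlap b' l p =
        ∑ γ, labelMass h y l (some γ) * labelOverlap b' l (some γ) * ∑ a, (b a γ : ℝ) := by
      simp only [Fintype.sum_option, labelOverlap, labelJump, mul_zero, zero_add]
      rw [Finset.sum_comm]
      simp only [Finset.mul_sum, Finset.sum_mul]
      refine Finset.sum_congr rfl fun γ _ => Finset.sum_congr rfl fun a _ =>
        Finset.sum_congr rfl fun γ' _ => by ring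
    have e2 : ∑ γ, labelMass h y l (some γ) * labelOverlap b' l (some γ) * M =
        ∑ γ' ∈ l, (∑ γ, (h γ * |y|) ^ 2 * b' γ γ') * M +
          (∑ γ ∈ l, labelOverlap b' l (some γ)) * M := by
      simp only [labelMass, add_mul, Finset.sum_add_distrib]
      congr 1
      · simp only [labelOverlap, Finset.mul_sum, Finset.sum_mul]
        rw [Finset.sum_comm]
      · simp only [ite_mul, one_mul, zero_mul, Finset.sum_ite_mem, Finset.univ_inter,
          Finset.sum_mul]
    rw [e1]
    refine (Finset.sum_le_sum fun γ _ => mul_le_mul_of_nonneg_left (hb.sum_jumps γ)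
      (mul_nonneg (labelMass_nonneg _ _) (labelOverlap_nonneg _ _ _))).trans ?_
    rw [e2]
    have h1 : ∑ γ' ∈ l, (∑ γ, (h γ * |y|) ^ 2 * b' γ γ') * M ≤ l.card * M := by
      simpa using Finset.sum_le_card_nsmul l _ M fun γ' _ => hb.sum_neighbours γ'
    have h2 : ∀ γ ∈ l, labelOverlap b' l (some γ) ≤ 3 := fun γ _ => by
      refine le_trans ?_ hl'
      simpa [labelOverlap] using
        Finset.sum_le_card_nsmul l (fun γ' => (b' γ γ' : ℝ)) 1 fun γ' _ => hbr' γ γ'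
    have h3 : ∑ γ ∈ l, labelOverlap b' l (some γ) ≤ 9 := by
      have := Finset.sum_le_card_nsmul l _ 3 h2
      simp only [nsmul_eq_mul] at this
      linarith
    have h4 : (∑ γ ∈ l, labelOverlap b' l (some γ)) * M ≤ 9 * M := by gcongr
    linarith
  have hβ1 : ∀ a p, labelJump b a p ≤ 1 := by
    rintro a (_ | γ)
    · exact le_rfl
    · exact hbr a γ
  -- With `c = 5`, `t = 3M`, `r = 12M` the bound is `(75 + 120 + 15 + 24) M = 234 M`.
  refine (sum_pair_le (labelMass h y l) (labelOverlap b' l) (labelJump b) (jumpOverlap b l)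
    (by norm_num) (labelMass_nonneg l) (labelOverlap_nonneg b' l) (jumpOverlap_nonneg b l)
    (labelJump_nonneg b) hβ1 hP hR hT).trans (by linarith)

/-- The one-step bound. Here `1872 = 4 * 2 * 234`: a factor 2 from each of the two toggles, the 2 in
`pairNorm`, and the count of labels and jumps. -/
lemma CountingBounds.sum_pairNorm_le (hb : CountingBounds h y M b b') {u l : Finset Γ}
    (hul : u ⊆ l) (hl : l.card ≤ 3) :
    ∑ p, ∑ q, monomialWeight h y (toggle p (toggle q u)) * pairNorm h y b b' l p q ≤
      1872 * M * monomialWeight h y u := by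
  have hu := monomialWeight_nonneg (y := y) hb.strength_nonneg u
  calc _ ≤ ∑ p, ∑ q, 8 * monomialWeight h y u *
        (labelMass h y l q * (labelMass h y l p + if p = q then 1 else 0) *
          ∑ a, labelJump b a p * labelJump b a q *
            (jumpOverlap b l a + labelOverlap b' l p + labelOverlap b' l q)) := by
        refine Finset.sum_le_sum fun p _ => Finset.sum_le_sum fun q _ => ?_
        have h1 := mul_le_mul_of_nonneg_right
          (monomialWeight_toggle_toggle_le (y := y) hb.strength_nonneg p q hul)
          (sum_labelJump_mul_nonneg b b' l p q)
        simp only [pairNorm]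
        linarith
    _ ≤ 8 * monomialWeight h y u * (234 * M) := by
        simp only [← Finset.mul_sum]
        exact mul_le_mul_of_nonneg_left (hb.sum_labels_le hl) (by positivity)
    _ = _ := by ring

end Counting

/-! ### Operators that commute up to sign, and the action of the dissipator on them. -/

section Tame

variable {V : Type} [NormedAddCommGroup V] [InnerProductSpace ℂ V]
variable {Γ J : Type}

/-- `X` commutes with every jump and Hamiltonian term up to a sign, and anticommutes only with
those that anticommute with a term with label in `l`. -/
structure Tame (H : Γ → (V →L[ℂ] V)) (A : J → (V →L[ℂ] V)) (b : J → Γ → ℕ) (b' : Γ → Γ → ℕ)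
    (l : Finset Γ) (X : V →L[ℂ] V) : Prop where
  jump : ∀ a, A a * X = X * A a ∨ (A a * X = -(X * A a) ∧ ∃ γ ∈ l, b a γ = 1)
  term : ∀ γ, H γ * X = X * H γ ∨ (H γ * X = -(X * H γ) ∧ ∃ γ' ∈ l, b' γ γ' = 1)

variable {H : Γ → (V →L[ℂ] V)} {A : J → (V →L[ℂ] V)} {b : J → Γ → ℕ} {b' : Γ → Γ → ℕ}
variable {l l' : Finset Γ} {X Y : V →L[ℂ] V}

lemma Tame.smul (hX : Tame H A b b' l X) (c : ℂ) : Tame H A b b' l (c • X) := by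
  constructor
  · intro a
    refine (hX.jump a).imp (fun h => ?_) (And.imp_left fun h => ?_) <;> simp [h]
  · intro γ
    refine (hX.term γ).imp (fun h => ?_) (And.imp_left fun h => ?_) <;> simp [h]

lemma Tame.one : Tame H A b b' ∅ 1 := ⟨fun a => by simp, fun γ => by simp⟩

lemma mul_mul_comm_or_anticomm {Z : V →L[ℂ] V} {p q : Prop}
    (hX : Z * X = X * Z ∨ (Z * X = -(X * Z) ∧ p))
    (hY : Z * Y = Y * Z ∨ (Z * Y = -(Y * Z) ∧ q)) :
    Z * (X * Y) = X * Y * Z ∨ (Z * (X * Y) = -(X * Y * Z) ∧ (p ∨ q)) := by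
  rcases hX with hX | ⟨hX, hp⟩ <;> rcases hY with hY | ⟨hY, hq⟩
  · left; rw [← mul_assoc, hX, mul_assoc, hY, mul_assoc]
  · right; exact ⟨by rw [← mul_assoc, hX, mul_assoc, hY, mul_neg, mul_assoc], .inr hq⟩
  · right; exact ⟨by rw [← mul_assoc, hX, neg_mul, mul_assoc, hY, mul_assoc], .inl hp⟩
  · left; rw [← mul_assoc, hX, neg_mul, mul_assoc, hY, mul_neg, neg_neg, mul_assoc]

lemma Tame.mul [DecidableEq Γ] (hX : Tame H A b b' l X) (hY : Tame H A b b' l' Y) :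
    Tame H A b b' (l ∪ l') (X * Y) := by
  constructor
  · intro a
    refine (mul_mul_comm_or_anticomm (hX.jump a) (hY.jump a)).imp id (And.imp_right ?_)
    rintro (⟨γ, h1, h2⟩ | ⟨γ, h1, h2⟩)
    · exact ⟨γ, Finset.mem_union_left _ h1, h2⟩
    · exact ⟨γ, Finset.mem_union_right _ h1, h2⟩
  · intro a
    refine (mul_mul_comm_or_anticomm (hX.term a) (hY.term a)).imp id (And.imp_right ?_)
    rintro (⟨γ, h1, h2⟩ | ⟨γ, h1, h2⟩)
    · exact ⟨γ, Finset.mem_union_left _ h1, h2⟩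
    · exact ⟨γ, Finset.mem_union_right _ h1, h2⟩

lemma comm_or_anticomm_of_lie_eq {β : ℕ} (hβ : β = 0 ∨ β = 1)
    (h : ⁅X, Y⁆ = (β : ℂ) • ((2 : ℂ) • (X * Y))) :
    X * Y = Y * X ∨ (X * Y = -(Y * X) ∧ β = 1) := by
  rw [Ring.lie_def] at h
  rcases hβ with rfl | rfl
  · left; simpa [sub_eq_zero] using h
  · right
    refine ⟨?_, rfl⟩
    rw [Nat.cast_one, one_smul, two_smul, sub_eq_iff_eq_add] at h
    rw [eq_neg_iff_add_eq_zero]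
    have h' : X * Y + (X * Y + Y * X) = X * Y + 0 := by rw [add_zero, ← add_assoc, ← h]
    exact add_left_cancel h'

/-- The factor `H_p` of a monomial, with `H_none = 1`. -/
def labelTerm (H : Γ → (V →L[ℂ] V)) : Option Γ → (V →L[ℂ] V)
  | none => 1
  | some γ => H γ

lemma Tame.exists_jump_sign (hX : Tame H A b b' l X) (a : J) :
    ∃ ε : ℝ, A a * X = (ε : ℂ) • (X * A a) ∧ (ε = 1 ∨ ε = -1 ∧ 1 ≤ jumpOverlap b l a) := by
  rcases hX.jump a with h | ⟨h, γ, hγ, hb⟩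
  · exact ⟨1, by simpa using h, .inl rfl⟩
  · exact ⟨-1, by simpa using h, .inr ⟨rfl, one_le_jumpOverlap hγ hb⟩⟩

lemma Tame.exists_label_sign (hX : Tame H A b b' l X) (p : Option Γ) :
    ∃ ε : ℝ, labelTerm H p * X = (ε : ℂ) • (X * labelTerm H p) ∧
      (ε = 1 ∨ ε = -1 ∧ 1 ≤ labelOverlap b' l p) := by
  rcases p with _ | γ
  · exact ⟨1, by simp [labelTerm], .inl rfl⟩
  rcases hX.term γ with h | ⟨h, γ', hγ, hb⟩
  · exact ⟨1, by simpa [labelTerm] using h, .inl rfl⟩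
  · exact ⟨-1, by simpa [labelTerm] using h, .inr ⟨rfl, one_le_labelOverlap hγ hb⟩⟩

variable [CompleteSpace V] {n : ℕ} {𝒜 : Fin n → Subalgebra ℂ (V →L[ℂ] V)}
  {h : Γ → ℝ} {y : ℝ}

/-- The scalar in front of `A^a H_p` in the Lindblad operator. -/
noncomputable def labelScalar (b : J → Γ → ℕ) (y : ℝ) (a : J) : Option Γ → ℝ
  | none => 1
  | some γ => 2 * y * b a γ

lemma CommutationCondition.tame_term (hc : CommutationCondition 𝒜 H A b b') (γ : Γ) :
    Tame H A b b' {γ} (H γ) := by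
  constructor
  · intro a
    simpa using comm_or_anticomm_of_lie_eq (hc.jump_mem a γ) (hc.jump_comm a γ)
  · intro γ'
    simpa using comm_or_anticomm_of_lie_eq (hc.term_mem γ' γ) (hc.term_comm γ' γ)

lemma CommutationCondition.tame_labelTerm (hc : CommutationCondition 𝒜 H A b b')
    (p : Option Γ) : Tame H A b b' p.toFinset (labelTerm H p) := by
  rcases p with _ | γ
  · exact Tame.one
  · exact hc.tame_term γ

lemma CommutationCondition.lindbladOperatorCoeff_eq (hc : CommutationCondition 𝒜 H A b b')
    (a : J) (p : Option Γ) :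
    lindbladOperatorCoeff H A y a p = (labelScalar b y a p : ℂ) • (A a * labelTerm H p) := by
  rcases p with _ | γ
  · simp [lindbladOperatorCoeff, labelScalar, labelTerm]
  · simp only [lindbladOperatorCoeff, labelScalar, labelTerm, hc.jump_comm, smul_smul]
    congr 1
    push_cast
    ring

lemma star_lindbladOperatorCoeff (hs : SquareCondition H h)
    (hc : CommutationCondition 𝒜 H A b b') (a : J) (p : Option Γ) :
    star (lindbladOperatorCoeff H A y a p) =
      (labelScalar b y a p : ℂ) • (labelTerm H p * A a) := by
  have hp : star (labelTerm H p) = labelTerm H p := by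
    rcases p with _ | γ
    · simp [labelTerm]
    · exact hs.isSelfAdjoint γ
  rw [hc.lindbladOperatorCoeff_eq, star_smul, star_mul, hp, (hc.jump_isSelfAdjoint a).star_eq]
  simp

/-- Moving `X` to the left leaves only signs, and the two copies of `A a` cancel through `A a * A a
= 1`. If all signs are `+1`, the gain and loss terms cancel; otherwise the scalar is at most 2 in
absolute value and some overlap is at least 1. -/
lemma Tame.exists_dissipator_eq (hX : Tame H A b b' l X) (hs : SquareCondition H h)
    (hc : CommutationCondition 𝒜 H A b b') (a : J) (p q : Option Γ) :
    ∃ c : ℝ, dissipator (lindbladOperatorCoeff H A y a p) (lindbladOperatorCoeff H A y a q) X =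
        ((labelScalar b y a p * labelScalar b y a q * c : ℝ) : ℂ) •
          (X * (labelTerm H p * labelTerm H q)) ∧
      |c| ≤ 2 * (jumpOverlap b l a + labelOverlap b' l p + labelOverlap b' l q) := by
  obtain ⟨ε, hε, hε'⟩ := hX.exists_jump_sign a
  obtain ⟨δ, hδ, hδ'⟩ := hX.exists_label_sign p
  obtain ⟨δ₁, hδ₁, hδ₁'⟩ := hX.exists_label_sign q
  -- The signs come from `P† X Q`, from `P† Q X` and from `X P† Q`, in this order.
  refine ⟨ε * δ - (δ * δ₁ + 1) / 2, ?_, ?_⟩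
  · rw [dissipator, star_lindbladOperatorCoeff hs hc, hc.lindbladOperatorCoeff_eq]
    set G := labelTerm H p
    set G₁ := labelTerm H q
    have e1 : G * A a * X * (A a * G₁) = ((ε * δ : ℝ) : ℂ) • (X * (G * G₁)) := by
      calc G * A a * X * (A a * G₁) = G * (A a * X) * (A a * G₁) := by noncomm_ring
        _ = (ε : ℂ) • ((G * X) * (A a * A a) * G₁) := by
          rw [hε]; simp only [mul_smul_comm, smul_mul_assoc, mul_assoc]
        _ = _ := by
          rw [hc.jump_sq, hδ, mul_one, smul_mul_assoc, smul_smul, mul_assoc]; push_cast; rfl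
    have e2 : G * A a * (A a * G₁) = G * G₁ := by
      calc G * A a * (A a * G₁) = G * (A a * A a) * G₁ := by noncomm_ring
        _ = _ := by rw [hc.jump_sq, mul_one]
    have e3 : G * G₁ * X = ((δ * δ₁ : ℝ) : ℂ) • (X * (G * G₁)) := by
      rw [mul_assoc, hδ₁, mul_smul_comm, ← mul_assoc, hδ, smul_mul_assoc, smul_smul, mul_assoc]
      push_cast; rw [mul_comm]
    simp only [smul_mul_assoc, mul_smul_comm, e1, e2, e3]
    push_cast
    module
  · have h1 := jumpOverlap_nonneg b l a
    have h2 := labelOverlap_nonneg b' l p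
    have h3 := labelOverlap_nonneg b' l q
    rcases hε' with rfl | ⟨rfl, hε'⟩ <;> rcases hδ' with rfl | ⟨rfl, hδ'⟩ <;>
      rcases hδ₁' with rfl | ⟨rfl, hδ₁'⟩ <;> norm_num [abs_of_nonneg, abs_of_neg] <;> linarith

lemma norm_le_of_square (hs : SquareCondition H h) (γ : Γ) : ‖H γ‖ ≤ h γ := by
  have h1 : ‖H γ‖ * ‖H γ‖ ≤ h γ ^ 2 := by
    rw [← CStarRing.norm_star_mul_self, (hs.isSelfAdjoint γ).star_eq, hs.sq_eq, norm_smul]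
    -- Only `‖1‖ ≤ 1` is available, since `V` may be zero.
    refine (mul_le_mul_of_nonneg_left ContinuousLinearMap.norm_id_le (norm_nonneg _)).trans ?_
    simp
  exact le_of_sq_le_sq (by simpa [sq] using h1) (hs.nonneg γ)

lemma abs_labelScalar_mul_norm_le (hs : SquareCondition H h) (a : J) (p : Option Γ) :
    |labelScalar b y a p| * ‖labelTerm H p‖ ≤ labelJump b a p * labelStrength h y p := by
  rcases p with _ | γ
  · simp only [labelScalar, labelTerm, labelJump, labelStrength, abs_one, one_mul]
    exact ContinuousLinearMap.norm_id_le
  · have h1 := norm_le_of_square hs γ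
    simp only [labelScalar, labelTerm, labelJump, labelStrength, abs_mul, abs_two, Nat.abs_cast]
    calc 2 * |y| * (b a γ : ℝ) * ‖H γ‖ ≤ 2 * |y| * (b a γ : ℝ) * h γ := by gcongr
      _ = _ := by ring

variable [Fintype J]

/-- All jumps produce multiples of the same operator `X H_p H_q`, so the sum over jumps stays tame.
This is what allows a second application. -/
lemma Tame.lindbladianCoeff [DecidableEq Γ] (hX : Tame H A b b' l X) (hs : SquareCondition H h)
    (hc : CommutationCondition 𝒜 H A b b') (p q : Option Γ) :
    Tame H A b b' (l ∪ (p.toFinset ∪ q.toFinset)) (lindbladianCoeff H A y p q X) := by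
  choose c hc1 _ using fun a => hX.exists_dissipator_eq (y := y) hs hc a p q
  simp only [LocalHamiltonian.lindbladianCoeff, hc1, ← Finset.sum_smul]
  exact (hX.mul ((hc.tame_labelTerm p).mul (hc.tame_labelTerm q))).smul _

lemma Tame.norm_lindbladianCoeff_le (hX : Tame H A b b' l X) (hs : SquareCondition H h)
    (hc : CommutationCondition 𝒜 H A b b') (p q : Option Γ) :
    ‖LocalHamiltonian.lindbladianCoeff H A y p q X‖ ≤ pairNorm h y b b' l p q * ‖X‖ := by
  simp only [LocalHamiltonian.lindbladianCoeff, pairNorm, Finset.mul_sum, Finset.sum_mul]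
  refine norm_sum_le_of_le _ fun a _ => ?_
  obtain ⟨c, h1, h2⟩ := hX.exists_dissipator_eq (y := y) hs hc a p q
  have hp := abs_labelScalar_mul_norm_le (b := b) (y := y) hs a p
  have hq := abs_labelScalar_mul_norm_le (b := b) (y := y) hs a q
  rw [h1, norm_smul, Complex.norm_real, Real.norm_eq_abs, abs_mul, abs_mul]
  calc _ ≤ |labelScalar b y a p| * |labelScalar b y a q| * |c| *
        (‖X‖ * (‖labelTerm H p‖ * ‖labelTerm H q‖)) := by
        gcongr
        exact (norm_mul_le _ _).trans (by gcongr; exact norm_mul_le _ _)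
    _ = (|labelScalar b y a p| * ‖labelTerm H p‖) * (|labelScalar b y a q| * ‖labelTerm H q‖) *
        |c| * ‖X‖ := by ring
    _ ≤ (labelJump b a p * labelStrength h y p) * (labelJump b a q * labelStrength h y q) *
        (2 * (jumpOverlap b l a + labelOverlap b' l p + labelOverlap b' l q)) * ‖X‖ := by
        have := mul_nonneg (labelJump_nonneg b a p) (labelStrength_nonneg (y := y) hs.nonneg p)
        have := mul_nonneg (labelJump_nonneg b a q) (labelStrength_nonneg (y := y) hs.nonneg q)
        gcongr
    _ = _ := by ring

lemma sum_monomialWeight_mul_norm_expansionCoeff_le [Fintype Γ] [DecidableEq Γ] {M : ℝ}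
    (hs : SquareCondition H h) (hc : CommutationCondition 𝒜 H A b b')
    (hb : CountingBounds h y M b b') (T : Finset (Finset Γ)) :
    ∑ U ∈ T, monomialWeight h y U * ‖expansionCoeff H A y U‖ ≤
      1872 ^ 2 * M ^ 2 * (|y| * ∑ γ, h γ ^ 2) := by
  have hw : ∀ u, 0 ≤ monomialWeight h y u := monomialWeight_nonneg hs.nonneg
  have hM := hb.nonneg
  have hsurv : ∀ γ₀ : Γ, ∀ p₁ p₂ p₃ p₄, survivingSigns [some γ₀, p₁, p₂, p₃, p₄] =
      toggle p₄ (toggle p₃ (toggle p₂ (toggle p₁ {γ₀}))) := by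
    intro γ₀ p₁ p₂ p₃ p₄
    -- Reversing the list nests the toggles in the order in which the labels are appended, with `γ₀`
    -- innermost.
    rw [survivingSigns_perm (List.reverse_perm [some γ₀, p₁, p₂, p₃, p₄]).symm]
    simp only [List.reverse_cons, List.reverse_nil, List.nil_append, List.cons_append,
      survivingSigns_cons, survivingSigns_nil, toggle_some_of_notMem (Finset.notMem_empty γ₀)]
    rfl
  have step1 : ∑ U ∈ T, monomialWeight h y U * ‖expansionCoeff H A y U‖ ≤
      ∑ γ₀ : Γ, ∑ p₁ : Option Γ, ∑ p₂ : Option Γ, ∑ p₃ : Option Γ, ∑ p₄ : Option Γ,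
        monomialWeight h y (toggle p₄ (toggle p₃ (toggle p₂ (toggle p₁ {γ₀})))) *
          ‖LocalHamiltonian.lindbladianCoeff H A y p₄ p₃
            (LocalHamiltonian.lindbladianCoeff H A y p₂ p₁ (H γ₀))‖ := by
    calc _ ≤ ∑ U ∈ T, ∑ γ₀ : Γ, ∑ p₁ : Option Γ, ∑ p₂ : Option Γ, ∑ p₃ : Option Γ,
          ∑ p₄ : Option Γ, if survivingSigns [some γ₀, p₁, p₂, p₃, p₄] = U then
            monomialWeight h y U * ‖LocalHamiltonian.lindbladianCoeff H A y p₄ p₃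
              (LocalHamiltonian.lindbladianCoeff H A y p₂ p₁ (H γ₀))‖ else 0 := by
          refine Finset.sum_le_sum fun U _ => ?_
          refine (mul_le_mul_of_nonneg_left (norm_sum_le_of_le _ fun γ₀ _ =>
            norm_sum_le_of_le _ fun p₁ _ => norm_sum_le_of_le _ fun p₂ _ =>
            norm_sum_le_of_le _ fun p₃ _ => norm_sum_le _ _) (hw U)).trans (le_of_eq ?_)
          simp only [Finset.mul_sum, apply_ite norm, norm_zero, mul_ite, mul_zero]
      _ ≤ _ := by
          rw [Finset.sum_comm]; refine Finset.sum_le_sum fun γ₀ _ => ?_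
          rw [Finset.sum_comm]; refine Finset.sum_le_sum fun p₁ _ => ?_
          rw [Finset.sum_comm]; refine Finset.sum_le_sum fun p₂ _ => ?_
          rw [Finset.sum_comm]; refine Finset.sum_le_sum fun p₃ _ => ?_
          rw [Finset.sum_comm]; refine Finset.sum_le_sum fun p₄ _ => ?_
          rw [Finset.sum_ite_eq, hsurv]
          split_ifs
          · exact le_rfl
          · exact mul_nonneg (hw _) (norm_nonneg _)
  have step2 : ∀ (γ₀ : Γ) (p₁ p₂ : Option Γ), ∑ p₃ : Option Γ, ∑ p₄ : Option Γ,
      monomialWeight h y (toggle p₄ (toggle p₃ (toggle p₂ (toggle p₁ {γ₀})))) *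
        ‖LocalHamiltonian.lindbladianCoeff H A y p₄ p₃
          (LocalHamiltonian.lindbladianCoeff H A y p₂ p₁ (H γ₀))‖ ≤
      1872 * M * monomialWeight h y (toggle p₂ (toggle p₁ {γ₀})) *
        (pairNorm h y b b' {γ₀} p₂ p₁ * h γ₀) := by
    intro γ₀ p₁ p₂
    have hX := (hc.tame_term γ₀).lindbladianCoeff (y := y) hs hc p₂ p₁
    have hn : ‖LocalHamiltonian.lindbladianCoeff H A y p₂ p₁ (H γ₀)‖ ≤
        pairNorm h y b b' {γ₀} p₂ p₁ * h γ₀ :=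
      ((hc.tame_term γ₀).norm_lindbladianCoeff_le hs hc p₂ p₁).trans
        (mul_le_mul_of_nonneg_left (norm_le_of_square hs γ₀)
          (pairNorm_nonneg hs.nonneg _ _ _))
    set X := LocalHamiltonian.lindbladianCoeff H A y p₂ p₁ (H γ₀)
    set l : Finset Γ := {γ₀} ∪ (p₂.toFinset ∪ p₁.toFinset) with hl
    -- After one application at most `γ₀`, `p₁` and `p₂` are present, which is the source of the 3
    -- in the counting lemmas.
    have hcard : l.card ≤ 3 := by
      have h1 : ∀ p : Option Γ, p.toFinset.card ≤ 1 := by rintro (_ | γ) <;> simp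
      have h2 := Finset.card_union_le {γ₀} (p₂.toFinset ∪ p₁.toFinset)
      have h3 := Finset.card_union_le p₂.toFinset p₁.toFinset
      have := h1 p₁; have := h1 p₂
      have := Finset.card_singleton γ₀
      rw [hl]
      omega
    have hul : toggle p₂ (toggle p₁ {γ₀}) ⊆ l := by
      intro α
      simp only [hl, toggle, Finset.mem_symmDiff, Finset.mem_union]
      tauto
    calc _ ≤ ∑ p₃ : Option Γ, ∑ p₄ : Option Γ,
          monomialWeight h y (toggle p₄ (toggle p₃ (toggle p₂ (toggle p₁ {γ₀})))) *
            pairNorm h y b b' l p₄ p₃ * ‖X‖ := by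
          refine Finset.sum_le_sum fun p₃ _ => Finset.sum_le_sum fun p₄ _ => ?_
          rw [mul_assoc]
          exact mul_le_mul_of_nonneg_left (hX.norm_lindbladianCoeff_le hs hc p₄ p₃) (hw _)
      _ ≤ 1872 * M * monomialWeight h y (toggle p₂ (toggle p₁ {γ₀})) * ‖X‖ := by
          rw [Finset.sum_comm]
          simp only [← Finset.sum_mul]
          exact mul_le_mul_of_nonneg_right (hb.sum_pairNorm_le hul hcard) (norm_nonneg _)
      _ ≤ _ := mul_le_mul_of_nonneg_left hn (mul_nonneg (by positivity) (hw _))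
  have step3 : ∀ γ₀ : Γ, ∑ p₁ : Option Γ, ∑ p₂ : Option Γ,
      1872 * M * monomialWeight h y (toggle p₂ (toggle p₁ {γ₀})) *
        (pairNorm h y b b' {γ₀} p₂ p₁ * h γ₀) ≤ 1872 ^ 2 * M ^ 2 * (|y| * h γ₀ ^ 2) := by
    intro γ₀
    have h1 := hb.sum_pairNorm_le (u := {γ₀}) (l := {γ₀}) subset_rfl (by simp)
    have h2 : 0 ≤ 1872 * M * h γ₀ := mul_nonneg (by positivity) (hs.nonneg γ₀)
    calc _ = 1872 * M * h γ₀ * ∑ p, ∑ q, monomialWeight h y (toggle p (toggle q {γ₀})) *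
          pairNorm h y b b' {γ₀} p q := by
          rw [Finset.sum_comm]
          simp only [Finset.mul_sum]
          exact Finset.sum_congr rfl fun p _ => Finset.sum_congr rfl fun q _ => by ring
      _ ≤ 1872 * M * h γ₀ * (1872 * M * monomialWeight h y {γ₀}) :=
          mul_le_mul_of_nonneg_left h1 h2
      _ = _ := by simp only [monomialWeight, Finset.prod_singleton]; ring
  refine step1.trans ((Finset.sum_le_sum fun γ₀ _ => (Finset.sum_le_sum fun p₁ _ =>
    Finset.sum_le_sum fun p₂ _ => step2 γ₀ p₁ p₂).trans (step3 γ₀)).trans (le_of_eq ?_))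
  simp only [Finset.mul_sum]

end Tame

/-! ### Counting bounds from locality. -/

section Locality

variable {V : Type} [NormedAddCommGroup V] [InnerProductSpace ℂ V]
variable {Γ J : Type} [Fintype Γ] [Fintype J] {n k : ℕ}
  {𝒜 : Fin n → Subalgebra ℂ (V →L[ℂ] V)} {H : Γ → (V →L[ℂ] V)} {A : J → (V →L[ℂ] V)}
  {b : J → Γ → ℕ} {b' : Γ → Γ → ℕ} {h : Γ → ℝ} {y aloc aac : ℝ}

open Classical in
lemma sum_sq_le_localEnergy_sq (i : Fin n) :
    ∑ γ with i ∈ support 𝒜 (H γ), h γ ^ 2 ≤ localEnergy 𝒜 H h ^ 2 := by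
  have h0 : 0 ≤ ∑ γ with i ∈ support 𝒜 (H γ), h γ ^ 2 := Finset.sum_nonneg fun _ _ => sq_nonneg _
  have h1 : √(∑ γ with i ∈ support 𝒜 (H γ), h γ ^ 2) ≤ localEnergy 𝒜 H h :=
    le_ciSup (f := fun i : Fin n => √(∑ γ with i ∈ support 𝒜 (H γ), h γ ^ 2))
      (Set.finite_range _).bddAbove i
  calc _ = √(∑ γ with i ∈ support 𝒜 (H γ), h γ ^ 2) ^ 2 := (Real.sq_sqrt h0).symm
    _ ≤ _ := by gcongr

lemma sum_mass_le_of_site (i : Fin n) {f : Γ → ℕ} (hf : ∀ γ, f γ ≤ 1)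
    (hi : ∀ γ, f γ = 1 → i ∈ support 𝒜 (H γ)) :
    ∑ γ, (h γ * |y|) ^ 2 * f γ ≤ y ^ 2 * localEnergy 𝒜 H h ^ 2 := by
  classical
  calc _ ≤ ∑ γ, y ^ 2 * if i ∈ support 𝒜 (H γ) then h γ ^ 2 else 0 := by
        refine Finset.sum_le_sum fun γ _ => ?_
        rw [mul_pow, sq_abs]
        rcases Nat.le_one_iff_eq_zero_or_eq_one.1 (hf γ) with h0 | h1
        · rw [h0]; split_ifs <;> simp; positivity
        · rw [h1, if_pos (hi γ h1)]; simp [mul_comm]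
    _ = y ^ 2 * ∑ γ with i ∈ support 𝒜 (H γ), h γ ^ 2 := by
        rw [← Finset.mul_sum, Finset.sum_filter]
    _ ≤ _ := mul_le_mul_of_nonneg_left (sum_sq_le_localEnergy_sq i) (sq_nonneg y)

/-- A jump sits on one site and a term on `k` sites, so the masses of the labels anticommuting with
them are at most `E` and `E * k`. Both are at most 1 by the smallness hypothesis once `aloc` and `k`
are at least 1; the case `aloc * k = 0` is degenerate. -/
lemma LocalityCondition.countingBounds [CompleteSpace V] [Nonempty Γ] (hs : SquareCondition H h)
    (hc : CommutationCondition 𝒜 H A b b') (hl : LocalityCondition 𝒜 H A b k aloc aac)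
    (hy : y ^ 2 * localEnergy 𝒜 H h ^ 2 * aloc * k < 1 / 8) :
    CountingBounds h y (aloc * k) b b' := by
  classical
  set E := y ^ 2 * localEnergy 𝒜 H h ^ 2 with hE
  have hE0 : 0 ≤ E := by positivity
  have hk : (0 : ℝ) ≤ k := Nat.cast_nonneg k
  have hjump : ∀ a γ, b a γ ≤ 1 := fun a γ => by rcases hc.jump_mem a γ with h | h <;> omega
  have hterm : ∀ γ γ', b' γ γ' ≤ 1 := fun a γ => by rcases hc.term_mem a γ with h | h <;> omega
  have hsum : ∀ γ, ∑ a, (b a γ : ℝ) ≤ aloc * k := fun γ => by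
    have := hl.anticomm_count γ
    push_cast at this
    rw [this]
    exact mul_le_mul_of_nonneg_right hl.aac_le_aloc hk
  have hM : 0 ≤ aloc * k :=
    (Finset.sum_nonneg fun _ _ => Nat.cast_nonneg _).trans (hsum (Classical.arbitrary Γ))
  -- `aloc` is the number of jumps on a single site, hence an integer as soon as a site exists.
  have hone : 0 < aloc * k → 1 ≤ aloc ∧ (1 : ℝ) ≤ k := by
    intro hpos
    have hk1 : 1 ≤ k := by
      rcases Nat.eq_zero_or_pos k with rfl | hk0
      · simp at hpos
      · exact hk0
    have hk1' : (1 : ℝ) ≤ k := by exact_mod_cast hk1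
    have hne : (support 𝒜 (H (Classical.arbitrary Γ))).Nonempty := by
      rw [← Set.ncard_pos, hl.term_card]; exact hk1
    obtain ⟨i, _⟩ := hne
    have hcount := hl.jump_count {i}
    rw [Finset.card_singleton, Nat.cast_one, mul_one] at hcount
    have hpos' : 0 < aloc := pos_of_mul_pos_left hpos hk
    rw [← hcount] at hpos' ⊢
    exact ⟨by exact_mod_cast Nat.cast_pos.1 hpos', hk1'⟩
  refine ⟨hs.nonneg, hM, hjump, hterm, hsum, fun a => ?_, fun γ' => ?_⟩
  · rcases hM.eq_or_lt with h0 | hpos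
    · have hb0 : ∀ γ, (b a γ : ℝ) = 0 := fun γ => by
        have h1 := Finset.single_le_sum (f := fun a => (b a γ : ℝ))
          (fun _ _ => Nat.cast_nonneg _) (Finset.mem_univ a)
        exact le_antisymm (h1.trans ((hsum γ).trans h0.ge)) (Nat.cast_nonneg _)
      simp [hb0]
    · obtain ⟨h1, h2⟩ := hone hpos
      obtain ⟨i, hi⟩ := hl.jump_single a
      refine (sum_mass_le_of_site (𝒜 := 𝒜) (H := H) i (hjump a) fun γ hγ => ?_).trans ?_
      · by_contra hni
        have := hc.jump_disjoint a γ (by rw [hi]; simpa using hni)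
        omega
      · nlinarith [mul_nonneg hE0 (sub_nonneg.2 (one_le_mul_of_one_le_of_one_le h1 h2))]
  · rcases hM.eq_or_lt with h0 | hpos
    · rw [← h0, mul_zero]
    obtain ⟨h1, h2⟩ := hone hpos
    refine mul_le_of_le_one_left hM ?_
    have hfin := Set.toFinite (support 𝒜 (H γ'))
    -- Union bound over the sites of `γ'`: an anticommuting term must share one of them.
    calc ∑ γ, (h γ * |y|) ^ 2 * (b' γ γ' : ℝ) ≤ ∑ i ∈ hfin.toFinset, ∑ γ, (h γ * |y|) ^ 2 *
          ((if i ∈ support 𝒜 (H γ) then 1 else 0 : ℕ) : ℝ) := by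
          rw [Finset.sum_comm]
          refine Finset.sum_le_sum fun γ _ => ?_
          rw [← Finset.mul_sum]
          refine mul_le_mul_of_nonneg_left ?_ (sq_nonneg _)
          rcases hc.term_mem γ γ' with h3 | h3
          · rw [h3, Nat.cast_zero]; exact Finset.sum_nonneg fun _ _ => Nat.cast_nonneg _
          · have hnd : ¬ Disjoint (support 𝒜 (H γ)) (support 𝒜 (H γ')) := fun hd => by
              have := hc.term_disjoint γ γ' hd; omega
            obtain ⟨i, hi, hi'⟩ := Set.not_disjoint_iff.1 hnd
            have h4 := Finset.single_le_sum
              (f := fun i => ((if i ∈ support 𝒜 (H γ) then 1 else 0 : ℕ) : ℝ))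
              (fun _ _ => Nat.cast_nonneg _) (hfin.mem_toFinset.2 hi')
            rw [h3]
            simpa [hi] using h4
      _ ≤ ∑ i ∈ hfin.toFinset, E := by
          refine Finset.sum_le_sum fun i _ => ?_
          exact sum_mass_le_of_site i (fun γ => by split_ifs <;> simp) fun γ hγ => by
            by_contra hni; simp [hni] at hγ
      _ = E * k := by
          rw [Finset.sum_const, nsmul_eq_mul, ← Set.ncard_eq_toFinset_card _ hfin,
            hl.term_card, mul_comm]
      _ ≤ 1 := by nlinarith [mul_nonneg (mul_nonneg hE0 hk) (sub_nonneg.2 h1)]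

end Locality

end LocalHamiltonian

/-! ### Assembly. -/

theorem mainTheorem5 :
    ∃ C : ℝ, ∀ (V : Type) [NormedAddCommGroup V] [InnerProductSpace ℂ V]
      [FiniteDimensional ℂ V] [CompleteSpace V]
      (Γ J : Type) [Fintype Γ] [DecidableEq Γ] [Fintype J]
      (n k : ℕ) (aloc aac y : ℝ)
      (𝒜 : Fin n → Subalgebra ℂ (V →L[ℂ] V))
      (H : Γ → (V →L[ℂ] V)) (h : Γ → ℝ) (A : J → (V →L[ℂ] V))
      (b : J → Γ → ℕ) (b' : Γ → Γ → ℕ),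
      LocalHamiltonian.SquareCondition H h →
      LocalHamiltonian.CommutationCondition 𝒜 H A b b' →
      LocalHamiltonian.LocalityCondition 𝒜 H A b k aloc aac →
      y ^ 2 * LocalHamiltonian.localEnergy 𝒜 H h ^ 2 * aloc * k < 1 / 8 →
      (∀ s : Γ → ℤˣ,
        LocalHamiltonian.lindbladian H A y s
            (LocalHamiltonian.lindbladian H A y s (LocalHamiltonian.hamiltonian H s)) =
          ∑ U : Finset Γ with U.card ≤ 5,
            (∏ α ∈ U, s α) • LocalHamiltonian.expansionCoeff H A y U) ∧
      ∑ U : Finset Γ with U.card ≤ 5,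
          (∏ α ∈ U, h α) * |y| ^ U.card * ‖LocalHamiltonian.expansionCoeff H A y U‖ ≤
        C * (|y| * aloc ^ 2 * (k : ℝ) ^ 2 * LocalHamiltonian.globalEnergy h ^ 2) := by

  refine ⟨1872 ^ 2, ?_⟩
  intro V _ _ _ _ Γ J _ _ _ n k aloc aac y 𝒜 H h A b b' hs hc hl hy
  refine ⟨LocalHamiltonian.lindbladian_lindbladian_hamiltonian H A y, ?_⟩
  simp only [← LocalHamiltonian.monomialWeight_eq]
  -- A term is needed to obtain `0 ≤ aloc * k`; without terms both sides vanish.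
  rcases isEmpty_or_nonempty Γ with hΓ | hΓ
  · simp [LocalHamiltonian.expansionCoeff, LocalHamiltonian.globalEnergy]
  · refine (LocalHamiltonian.sum_monomialWeight_mul_norm_expansionCoeff_le hs hc
      (hl.countingBounds hs hc hy) _).trans (le_of_eq ?_)
    rw [LocalHamiltonian.globalEnergy, Real.sq_sqrt (Finset.sum_nonneg fun _ _ => sq_nonneg _)]
    ring
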